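/- Let $m\ge 1$, let $S_j(x)=r_jx+d_j$ ($j=0,\dots,m$, $0<|r_j|<1$) be contracting similarities of $\mathbb{R}$, let $p_j>0$ with $\sum_{j=0}^m p_j=1$, and let $\mu$ be the associated self-similar measure, i.e. the Borel probability measure on $\mathbb{R}$ with $\mu(E)=\sum_{j=0}^m p_j\,\mu(S_j^{-1}(E))$ for all Borel sets $E$. For a finite word $w=(j_1,\dots,j_n)$ put $S_w=S_{j_1}\circ\cdots\circ S_{j_n}$, $r_w=r_{j_1}\cdots r_{j_n}$, $w^-=(j_1,\dots,j_{n-1})$, and let $r_{\min}=\min_j|r_j|$ and $\Lambda_n=\{w:|r_w|\le r_{\min}^n<|r_{w^-}|\}$ for $n\ge 1$, while $\Lambda_0$ consists of the empty word. Assume that the weak separation condition holds: there are $x_0\in\mathbb{R}$ and an integer $M$ such that for every $n$ and every finite word $\tau$, any closed ball of radius $r_{\min}^n$ contains at most $M$ distinct points of the form $S_\sigma(S_\tau(x_0))$ with $\sigma\in\Lambda_n$. Assume also that $\operatorname{supp}\mu=[0,1]$. Let $\Phi:(0,1)\to[0,\infty)$ be a dimension function, i.e. $x^{1+\Phi(x)}$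 decreases (not necessarily strictly) to $0$ as $x$ decreases to $0$. Assume that $\Phi$ is increasing (not necessarily strictly) and doubling, i.e. there is $c>0$ with $\Phi(x)\le c\,\Phi(x/2)$ for all $x\in(0,1)$. Let the upper $\Phi$-dimension $\overline{\dim}_\Phi\mu\in[-\infty,+\infty]$ be the infimum (with $\inf\emptyset=+\infty$) of all $\alpha\in\mathbb{R}$ for which there are $C_1\in(0,1)$ and $C_2>0$ such that $$\frac{\mu(B(x,R))}{\mu(B(x,r))}\le C_2\left(\frac Rr\right)^{\alpha}\quad\text{for all }x\in\operatorname{supp}\mu\text{ and all }0<r<R^{1+\Phi(R)}\le R\le C_1,$$ where $B(x,R)$ is the open ball. Then $\overline{\dim}_\Phi\mu<\infty$ if and only if $\mu$ is $\Phi$-doubling, i.e. if and only if there are constants $C\ge 1$ and $\gamma>0$ such that $$\mu(B(x,R))\le C R^{-\gamma\Phi(R)}\mu(B(x,R/2))\quad\text{for all }x\in\operatorname{supp}\mu\text{ and all }0<R\le 1$$ (for $R=1$, where $\Phi$ is not defined, the factor $R^{-\gamma\Phi(R)}$ is read as $1$). -/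

import Mathlib

open MeasureTheory Set Filter Topology

noncomputable section

/-! ## Dimension functions

A dimension function is a function on `(0,1)`. It is represented by a function `ℝ → ℝ` of which
only the values on `(0,1)` matter. -/

/-- `Φ : (0,1) → [0,∞)` is a dimension function if `x ^ (1 + Φ x)` decreases to `0` as `x`
decreases to `0`. -/
structure IsDimensionFunction (Φ : ℝ → ℝ) : Prop where
  nonneg : ∀ x ∈ Ioo (0 : ℝ) 1, 0 ≤ Φ x
  monotoneOn : MonotoneOn (fun x : ℝ => x ^ (1 + Φ x)) (Ioo 0 1)
  tendsto : Tendsto (fun x : ℝ => x ^ (1 + Φ x)) (𝓝[>] 0) (𝓝 0)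

/-- `Φ` is doubling: `Φ x ≤ c Φ (x / 2)` on its domain `(0,1)`, for some constant `c > 0`. -/
def IsDoublingFunction (Φ : ℝ → ℝ) : Prop :=
  ∃ c : ℝ, 0 < c ∧ ∀ x ∈ Ioo (0 : ℝ) 1, Φ x ≤ c * Φ (x / 2)

/-! ## The upper `Φ`-dimension and `Φ`-doubling of a (Borel probability) measure -/

section Measures

variable {X : Type*} [MetricSpace X] [MeasurableSpace X]

/-- The exponents `α` that compete in the definition of the upper `Φ`-dimension of `μ`.
As `Φ` lives on `(0,1)`, the threshold `C₁` is taken below `1`; decreasing `C₁` only weakens the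
requirement, so this does not change the set. -/
def upperPhiExponents (Φ : ℝ → ℝ) (μ : Measure X) : Set ℝ :=
  {α : ℝ | ∃ C₁ C₂ : ℝ, 0 < C₁ ∧ C₁ < 1 ∧ 0 < C₂ ∧
    ∀ r R : ℝ, 0 < r → r < R ^ (1 + Φ R) → R ^ (1 + Φ R) ≤ R → 0 < R → R ≤ C₁ →
      ∀ x ∈ μ.support,
        μ.real (Metric.ball x R) / μ.real (Metric.ball x r) ≤ C₂ * (R / r) ^ α}

/-- The upper `Φ`-dimension of `μ`: the infimum of the competing exponents, as an extended real
(the infimum of the empty set is `+∞`). -/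
def upperPhiDim (Φ : ℝ → ℝ) (μ : Measure X) : EReal :=
  ⨅ α ∈ upperPhiExponents Φ μ, (α : EReal)

/-- `μ` is `Φ`-doubling. At `R = 1` the factor `R ^ (-(γ * Φ R))` is `1`, whatever `Φ 1` is. -/
def IsPhiDoubling (Φ : ℝ → ℝ) (μ : Measure X) : Prop :=
  ∃ C γ : ℝ, 1 ≤ C ∧ 0 < γ ∧ ∀ x ∈ μ.support, ∀ R : ℝ, 0 < R → R ≤ 1 →
    μ.real (Metric.ball x R) ≤ C * R ^ (-(γ * Φ R)) * μ.real (Metric.ball x (R / 2))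

end Measures

/-! ## Iterated function systems of similarities on the line -/

/-- A contracting iterated function system `S j x = r j * x + d j`, `j = 0, …, m`, of similarities
of `ℝ`; the ratios may be negative. -/
structure SimilarityIFS (m : ℕ) where
  r : Fin (m + 1) → ℝ
  d : Fin (m + 1) → ℝ
  r_ne_zero : ∀ j, r j ≠ 0
  abs_r_lt_one : ∀ j, |r j| < 1

namespace SimilarityIFS

variable {m : ℕ} (𝓢 : SimilarityIFS m)

/-- The `j`-th map. -/
def map (j : Fin (m + 1)) (x : ℝ) : ℝ := 𝓢.r j * x + 𝓢.d j

/-- `S_w = S_{j₁} ∘ ⋯ ∘ S_{jₙ}` for the word `w = (j₁, …, jₙ)`. -/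
def wordMap (w : List (Fin (m + 1))) (x : ℝ) : ℝ := w.foldr 𝓢.map x

/-- `r_w = r_{j₁} ⋯ r_{jₙ}` for the word `w = (j₁, …, jₙ)`. -/
def wordRatio (w : List (Fin (m + 1))) : ℝ := (w.map 𝓢.r).prod

/-- `r_min = min_j |r_j|`. -/
def rMin : ℝ := Finset.univ.inf' Finset.univ_nonempty fun j => |𝓢.r j|

/-- `Λ_n`: the words `w` with `|r_w| ≤ r_min ^ n < |r_{w⁻}|`, where `w⁻` is `w` without its last
letter. (The empty word has no `w⁻`; it occurs only for `n = 0`, and `Λ_0` consists of it.) -/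
def level (n : ℕ) : Set (List (Fin (m + 1))) :=
  {w | |𝓢.wordRatio w| ≤ 𝓢.rMin ^ n ∧ (w ≠ [] → 𝓢.rMin ^ n < |𝓢.wordRatio w.dropLast|)}

/-- The weak separation condition: for some point `x₀` and some integer `M`, every closed ball of
radius `r_min ^ n` contains at most `M` distinct points `S_σ (S_τ x₀)`, `σ ∈ Λ_n`, for all `n` and
all words `τ`. -/
def WeakSeparation : Prop :=
  ∃ (x₀ : ℝ) (M : ℕ), ∀ (n : ℕ) (τ : List (Fin (m + 1))) (c : ℝ),
    ((fun σ => 𝓢.wordMap σ (𝓢.wordMap τ x₀)) '' 𝓢.level n ∩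
      Metric.closedBall c (𝓢.rMin ^ n)).encard ≤ M

/-- `μ` is the self-similar measure of the system with probabilities `p`. -/
structure IsSelfSimilarMeasure (p : Fin (m + 1) → ℝ) (μ : Measure ℝ) : Prop where
  p_pos : ∀ j, 0 < p j
  sum_p : ∑ j, p j = 1
  isProbabilityMeasure : IsProbabilityMeasure μ
  measure_eq : ∀ E : Set ℝ, MeasurableSet E →
    μ E = ∑ j, ENNReal.ofReal (p j) * μ (𝓢.map j ⁻¹' E)

end SimilarityIFS

end

/-!
The upper `Φ`-dimension of `μ` is finite exactly when some real exponent `α` competes in its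
definition.

Given such an `α`, the scales `R` and `R ^ (1 + Φ R) / 2 ≤ R / 2` have quotient `2 R ^ (-Φ R)`, and
comparing the masses of the balls with these radii is `Φ`-doubling with `γ = max α 1`. Radii bounded
away from `0` are covered by the lower bound `μ (B(z, v)) ≥ c v ^ s` for `z` in the support
(`exists_mul_pow_le_real_ball`).

Conversely, let `μ` be `Φ`-doubling and `r < R ^ (1 + Φ R)`. Iterating the doubling inequality from
`R` down to `r` would take about `log (R / r)` steps, which is too many. A single step at a scale
between `r` and `R` is harmless: it costs a constant times a fixed power of `R / r`, because
`R ^ (-Φ R) ≤ R / r` and `Φ` is increasing (`rpow_neg_mul_le_div_rpow`). So it is enough to use a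
bounded number of steps.

Write `μ` as the sum, over the distinct maps `f` among the `S_w`, `w ∈ Λ_n`, of `P f · μ ∘ f⁻¹`,
where `r_min ^ n` is comparable to `R`. By weak separation a bounded number of the pieces
`f '' [0, 1]` come close to the centre `x` (`WeakSeparation.exists_card_le`). Up to this number, the
mass of `B(x, t)` is at most the weight `P f` of the heaviest piece that it meets. If `δ`, the
distance of that piece to `x`, is at most `r / 2`, the piece has a proportion at least of order
`(r / R) ^ s` of its mass in `B(x, r)`. Otherwise it has at least the proportion of order
`(δ / R) ^ s` in `B(x, 2 δ)`, and one doubling step leads to `B(x, δ)`, which this piece does not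
meet. Each step removes a piece, so the number of steps is bounded (`le_pow_mul_of_finite_pieces`).
-/

/-! ### Words, their maps, ratios and weights -/

namespace SimilarityIFS

variable {m : ℕ} (𝓢 : SimilarityIFS m)

@[simp] lemma wordMap_cons (j : Fin (m + 1)) (w : List (Fin (m + 1))) (x : ℝ) :
    𝓢.wordMap (j :: w) x = 𝓢.map j (𝓢.wordMap w x) := rfl

@[simp] lemma wordMap_nil (x : ℝ) : 𝓢.wordMap [] x = x := rfl

@[simp] lemma wordRatio_cons (j : Fin (m + 1)) (w : List (Fin (m + 1))) :
    𝓢.wordRatio (j :: w) = 𝓢.r j * 𝓢.wordRatio w := by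
  simp [wordRatio]

@[simp] lemma wordRatio_nil : 𝓢.wordRatio [] = 1 := by
  simp [wordRatio]

lemma wordMap_sub (w : List (Fin (m + 1))) (x y : ℝ) :
    𝓢.wordMap w x - 𝓢.wordMap w y = 𝓢.wordRatio w * (x - y) := by
  induction w with
  | nil => simp
  | cons j w ih =>
    rw [wordMap_cons, wordMap_cons, wordRatio_cons, mul_assoc, ← ih, map, map]
    ring

lemma dist_wordMap (w : List (Fin (m + 1))) (x y : ℝ) :
    dist (𝓢.wordMap w x) (𝓢.wordMap w y) = |𝓢.wordRatio w| * dist x y := by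
  rw [Real.dist_eq, Real.dist_eq, wordMap_sub, abs_mul]

lemma continuous_wordMap (w : List (Fin (m + 1))) : Continuous (𝓢.wordMap w) := by
  have h : 𝓢.wordMap w = fun x => 𝓢.wordRatio w * x + 𝓢.wordMap w 0 := by
    ext x
    have := 𝓢.wordMap_sub w x 0
    linarith
  rw [h]
  fun_prop

lemma wordRatio_ne_zero (w : List (Fin (m + 1))) : 𝓢.wordRatio w ≠ 0 := by
  induction w with
  | nil => simp
  | cons j w ih => simpa using ⟨𝓢.r_ne_zero j, ih⟩

lemma abs_wordRatio_le_one (w : List (Fin (m + 1))) : |𝓢.wordRatio w| ≤ 1 := by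
  induction w with
  | nil => simp
  | cons j w ih =>
    rw [wordRatio_cons, abs_mul]
    exact mul_le_one₀ (𝓢.abs_r_lt_one j).le (abs_nonneg _) ih

lemma rMin_le (j : Fin (m + 1)) : 𝓢.rMin ≤ |𝓢.r j| :=
  Finset.inf'_le _ (Finset.mem_univ j)

lemma rMin_pos : 0 < 𝓢.rMin := by
  rw [rMin, Finset.lt_inf'_iff]
  exact fun j _ => abs_pos.2 (𝓢.r_ne_zero j)

lemma rMin_lt_one : 𝓢.rMin < 1 := (𝓢.rMin_le 0).trans_lt (𝓢.abs_r_lt_one 0)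

/-- The words of `Λ_n` have ratio comparable to `r_min ^ n`. -/
lemma rMin_pow_succ_le_of_mem_level {n : ℕ} {w : List (Fin (m + 1))} (hw : w ∈ 𝓢.level n) :
    𝓢.rMin ^ (n + 1) ≤ |𝓢.wordRatio w| := by
  rcases List.eq_nil_or_concat' w with rfl | ⟨v, j, rfl⟩
  · simpa using pow_le_one₀ 𝓢.rMin_pos.le 𝓢.rMin_lt_one.le
  · have h := hw.2 (by simp)
    rw [List.dropLast_concat] at h
    have e : 𝓢.wordRatio (v ++ [j]) = 𝓢.wordRatio v * 𝓢.r j := by simp [wordRatio]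
    rw [e, abs_mul, pow_succ]
    exact mul_le_mul h.le (𝓢.rMin_le j) 𝓢.rMin_pos.le (abs_nonneg _)

/-- The weight `p_w = p_{j₁} ⋯ p_{jₙ}` of the word `w = (j₁, …, jₙ)`. -/
def wordWeight (p : Fin (m + 1) → ℝ) (w : List (Fin (m + 1))) : ℝ := (w.map p).prod

lemma wordWeight_nonneg {p : Fin (m + 1) → ℝ} (hp : ∀ j, 0 < p j) (w : List (Fin (m + 1))) :
    0 ≤ wordWeight p w := by
  apply List.prod_nonneg
  simpa using fun j _ => (hp j).le

lemma pow_abs_wordRatio_le_wordWeight {p : Fin (m + 1) → ℝ} {s : ℕ}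
    (hs : ∀ j, |𝓢.r j| ^ s ≤ p j) (w : List (Fin (m + 1))) :
    |𝓢.wordRatio w| ^ s ≤ wordWeight p w := by
  induction w with
  | nil => simp [wordWeight]
  | cons j w ih =>
    have e : wordWeight p (j :: w) = p j * wordWeight p w := by simp [wordWeight]
    rw [e, wordRatio_cons, abs_mul, mul_pow]
    exact mul_le_mul (hs j) ih (by positivity) ((by positivity : (0 : ℝ) ≤ _).trans (hs j))

lemma exists_pow_abs_r_le {p : Fin (m + 1) → ℝ} (hp : ∀ j, 0 < p j) :
    ∃ s : ℕ, ∀ j, |𝓢.r j| ^ s ≤ p j := by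
  have h : ∀ᶠ s : ℕ in atTop, ∀ j, |𝓢.r j| ^ s ≤ p j := by
    rw [eventually_all]
    intro j
    exact ((tendsto_pow_atTop_nhds_zero_of_lt_one (abs_nonneg _)
      (𝓢.abs_r_lt_one j)).eventually_lt_const (hp j)).mono fun _ h => h.le
  exact h.exists

/-! ### Iterated self-similarity and lower mass bounds -/

namespace IsSelfSimilarMeasure

variable {𝓢} {p : Fin (m + 1) → ℝ} {μ : Measure ℝ}

lemma real_eq (hμ : 𝓢.IsSelfSimilarMeasure p μ) {E : Set ℝ} (hE : MeasurableSet E) :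
    μ.real E = ∑ j, p j * μ.real (𝓢.map j ⁻¹' E) := by
  have := hμ.isProbabilityMeasure
  rw [measureReal_def, hμ.measure_eq E hE, ENNReal.toReal_sum (fun j _ => by finiteness)]
  refine Finset.sum_congr rfl fun j _ => ?_
  rw [ENNReal.toReal_mul, ENNReal.toReal_ofReal (hμ.p_pos j).le, measureReal_def]

/-- The words whose ratio first drops to a threshold `t` form a finite set, over which the
self-similarity of `μ` can be iterated. The bound `b ^ N ≤ t`, with `b` a bound for all ratios,
carries the induction on the length of the words. -/
lemma exists_finset_of_threshold (hμ : 𝓢.IsSelfSimilarMeasure p μ) {b : ℝ}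
    (hb : ∀ j, |𝓢.r j| ≤ b) (N : ℕ) : ∀ t : ℝ, 0 < t → b ^ N ≤ t →
    ∃ F : Finset (List (Fin (m + 1))),
      (∀ w, w ∈ F ↔ |𝓢.wordRatio w| ≤ t ∧ (w ≠ [] → t < |𝓢.wordRatio w.dropLast|)) ∧
      ∀ E : Set ℝ, MeasurableSet E →
        μ.real E = ∑ w ∈ F, wordWeight p w * μ.real (𝓢.wordMap w ⁻¹' E) := by
  have base : ∀ t : ℝ, 1 ≤ t → ∃ F : Finset (List (Fin (m + 1))),
      (∀ w, w ∈ F ↔ |𝓢.wordRatio w| ≤ t ∧ (w ≠ [] → t < |𝓢.wordRatio w.dropLast|)) ∧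
      ∀ E : Set ℝ, MeasurableSet E →
        μ.real E = ∑ w ∈ F, wordWeight p w * μ.real (𝓢.wordMap w ⁻¹' E) := by
    intro t ht
    refine ⟨{[]}, fun w => ⟨?_, ?_⟩, fun E _ => ?_⟩
    · rintro hw
      rw [Finset.mem_singleton] at hw
      simpa [hw] using ht
    · rintro ⟨-, h⟩
      rw [Finset.mem_singleton]
      by_contra hw
      exact (h hw).not_ge ((𝓢.abs_wordRatio_le_one _).trans ht)
    · rw [Finset.sum_singleton]
      have : 𝓢.wordMap [] ⁻¹' E = E := rfl
      simp [this, wordWeight]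
  induction N with
  | zero => exact fun t _ ht => base t (by simpa using ht)
  | succ N ih =>
    intro t ht hbt
    rcases le_or_gt 1 t with h1 | h1
    · exact base t h1
    have hr : ∀ j, 0 < |𝓢.r j| := fun j => abs_pos.2 (𝓢.r_ne_zero j)
    have hj : ∀ j, b ^ N ≤ t / |𝓢.r j| := fun j => by
      rw [le_div_iff₀ (hr j)]
      have := (hr j).trans_le (hb j)
      exact (mul_le_mul_of_nonneg_left (hb j) (by positivity)).trans hbt
    choose F hF hFE using fun j => ih (t / |𝓢.r j|) (div_pos ht (hr j)) (hj j)
    refine ⟨(Finset.univ.sigma F).image fun q => q.1 :: q.2, fun w => ?_, fun E hE => ?_⟩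
    · cases w with
      | nil => simpa using h1
      | cons j w =>
        have e1 : |𝓢.r j| * |𝓢.wordRatio w| ≤ t ↔ |𝓢.wordRatio w| ≤ t / |𝓢.r j| := by
          rw [le_div_iff₀ (hr j), mul_comm]
        have e2 : w ≠ [] → (t < |𝓢.wordRatio (j :: w).dropLast| ↔
            t / |𝓢.r j| < |𝓢.wordRatio w.dropLast|) := fun hw => by
          rw [List.dropLast_cons_of_ne_nil hw, wordRatio_cons, abs_mul, div_lt_iff₀ (hr j),
            mul_comm]
        have e3 : (j :: w) ∈ (Finset.univ.sigma F).image (fun q => q.1 :: q.2) ↔ w ∈ F j := by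
          simp
        rw [e3, hF, wordRatio_cons, abs_mul, e1]
        refine and_congr_right fun _ => ⟨fun h _ => ?_, fun h hw => (e2 hw).1 (h (by simp))⟩
        by_cases hw : w = []
        · simpa [hw] using h1
        · exact (e2 hw).2 (h hw)
    · rw [hμ.real_eq hE, Finset.sum_image, Finset.sum_sigma]
      · refine Finset.sum_congr rfl fun j _ => ?_
        have hm : MeasurableSet (𝓢.map j ⁻¹' E) := by
          refine (Continuous.measurable ?_) hE
          unfold map
          fun_prop
        rw [hFE j _ hm, Finset.mul_sum]
        refine Finset.sum_congr rfl fun w _ => ?_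
        have e : 𝓢.wordMap (j :: w) ⁻¹' E = 𝓢.wordMap w ⁻¹' (𝓢.map j ⁻¹' E) := rfl
        simp [e, wordWeight, mul_assoc]
      · rintro ⟨j, w⟩ _ ⟨j', w'⟩ _ h
        simpa using h

/-- Self-similarity iterated over `Λ_n`: `μ = ∑_{w ∈ Λ_n} p_w · μ ∘ S_w⁻¹`. -/
lemma exists_finset_level (hμ : 𝓢.IsSelfSimilarMeasure p μ) (n : ℕ) :
    ∃ F : Finset (List (Fin (m + 1))), (∀ w, w ∈ F ↔ w ∈ 𝓢.level n) ∧
      ∀ E : Set ℝ, MeasurableSet E →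
        μ.real E = ∑ w ∈ F, wordWeight p w * μ.real (𝓢.wordMap w ⁻¹' E) := by
  let b := Finset.univ.sup' Finset.univ_nonempty fun j => |𝓢.r j|
  have hb : ∀ j, |𝓢.r j| ≤ b := fun j => Finset.le_sup' (fun j => |𝓢.r j|) (Finset.mem_univ j)
  have hb1 : b < 1 := by
    rw [Finset.sup'_lt_iff]
    exact fun j _ => 𝓢.abs_r_lt_one j
  have ht : 0 < 𝓢.rMin ^ n := pow_pos 𝓢.rMin_pos n
  obtain ⟨N, hN⟩ := exists_pow_lt_of_lt_one ht hb1
  exact hμ.exists_finset_of_threshold hb N _ ht hN.le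

/-- The level identity with the words grouped by the map they define. -/
lemma exists_finset_maps (hμ : 𝓢.IsSelfSimilarMeasure p μ) (n : ℕ) :
    ∃ (G : Finset (ℝ → ℝ)) (P : (ℝ → ℝ) → ℝ),
      (∀ f ∈ G, ∃ w ∈ 𝓢.level n, 𝓢.wordMap w = f) ∧ (∀ f, 0 ≤ P f) ∧
      ∀ E : Set ℝ, MeasurableSet E → μ.real E = ∑ f ∈ G, P f * μ.real (f ⁻¹' E) := by
  classical
  obtain ⟨F, hF, hFE⟩ := hμ.exists_finset_level n
  refine ⟨F.image 𝓢.wordMap, fun f => ∑ w ∈ F with 𝓢.wordMap w = f, wordWeight p w,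
    fun f hf => ?_, fun f => Finset.sum_nonneg fun w _ => wordWeight_nonneg hμ.p_pos w,
    fun E hE => ?_⟩
  · obtain ⟨w, hw, rfl⟩ := Finset.mem_image.1 hf
    exact ⟨w, (hF w).1 hw, rfl⟩
  · rw [hFE E hE, ← Finset.sum_fiberwise_of_maps_to fun w hw =>
      Finset.mem_image_of_mem 𝓢.wordMap hw]
    refine Finset.sum_congr rfl fun f _ => ?_
    rw [Finset.sum_mul]
    refine Finset.sum_congr rfl fun w hw => ?_
    rw [(Finset.mem_filter.1 hw).2]

lemma real_eq_zero (hsupp : μ.support = Icc (0 : ℝ) 1) {E : Set ℝ}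
    (hE : ∀ y ∈ Icc (0 : ℝ) 1, y ∉ E) : μ.real E = 0 := by
  rw [measureReal_def]
  have h : μ E = 0 := measure_mono_null (fun y hy => by
    rw [mem_compl_iff, hsupp]
    exact fun h => hE y h hy) Measure.measure_compl_support
  simp [h]

lemma real_ball_pos [IsFiniteMeasure μ] {x t : ℝ} (hx : x ∈ μ.support) (ht : 0 < t) :
    0 < μ.real (Metric.ball x t) := by
  rw [measureReal_def]
  exact ENNReal.toReal_pos
    ((Measure.mem_support_iff_forall x).1 hx _ (Metric.ball_mem_nhds x ht)).ne' (by finiteness)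

/-- Every point of the support is approximated by the pieces of every level. -/
lemma exists_mem_level_dist_lt (hμ : 𝓢.IsSelfSimilarMeasure p μ)
    (hsupp : μ.support = Icc (0 : ℝ) 1) (n : ℕ) {z v : ℝ} (hz : z ∈ Icc (0 : ℝ) 1)
    (hv : 0 < v) : ∃ w ∈ 𝓢.level n, ∃ y ∈ Icc (0 : ℝ) 1, dist (𝓢.wordMap w y) z < v := by
  have := hμ.isProbabilityMeasure
  by_contra! h
  obtain ⟨F, hF, hFE⟩ := hμ.exists_finset_level n
  have h0 := real_ball_pos (hsupp ▸ hz) hv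
  rw [hFE _ measurableSet_ball, Finset.sum_eq_zero] at h0
  · exact h0.false
  · intro w hw
    rw [real_eq_zero hsupp, mul_zero]
    exact fun y hy hy' => (h w ((hF w).1 hw) y hy).not_gt hy'

/-- Balls centred in the support have measure bounded below by a power of the radius. -/
lemma exists_mul_pow_le_real_ball (hμ : 𝓢.IsSelfSimilarMeasure p μ)
    (hsupp : μ.support = Icc (0 : ℝ) 1) :
    ∃ (c : ℝ) (s : ℕ), 0 < c ∧ ∀ z ∈ Icc (0 : ℝ) 1, ∀ v : ℝ, 0 < v → v ≤ 1 →
      c * v ^ s ≤ μ.real (Metric.ball z v) := by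
  have := hμ.isProbabilityMeasure
  have hr := 𝓢.rMin_pos
  obtain ⟨s, hs⟩ := 𝓢.exists_pow_abs_r_le hμ.p_pos
  refine ⟨(𝓢.rMin ^ 2 / 2) ^ s, s, by positivity, fun z hz v hv hv1 => ?_⟩
  obtain ⟨n, hn, hn'⟩ := exists_nat_pow_near_of_lt_one (half_pos hv) (by linarith) hr
    𝓢.rMin_lt_one
  obtain ⟨w, hw, y, hy, hyz⟩ := hμ.exists_mem_level_dist_lt hsupp (n + 1) hz (half_pos hv)
  obtain ⟨F, hF, hFE⟩ := hμ.exists_finset_level (n + 1)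
  have hone : μ.real (𝓢.wordMap w ⁻¹' Metric.ball z v) = 1 := by
    have hmeas : MeasurableSet (𝓢.wordMap w ⁻¹' Metric.ball z v) :=
      (𝓢.continuous_wordMap w).measurable measurableSet_ball
    have h0 : μ.real (𝓢.wordMap w ⁻¹' Metric.ball z v)ᶜ = 0 := by
      refine real_eq_zero hsupp fun y' hy' h => h ?_
      have h1 : dist y' y ≤ 1 := by simpa using Real.dist_le_of_mem_Icc hy' hy
      have h2 : dist (𝓢.wordMap w y') (𝓢.wordMap w y) ≤ v / 2 := by
        rw [dist_wordMap]
        exact (mul_le_of_le_one_right (abs_nonneg _) h1).trans (hw.1.trans hn.le)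
      exact Metric.mem_ball.2 ((dist_triangle _ _ _).trans_lt (by linarith))
    have := probReal_compl_eq_one_sub (μ := μ) hmeas
    linarith
  calc (𝓢.rMin ^ 2 / 2) ^ s * v ^ s = (𝓢.rMin ^ 2 * (v / 2)) ^ s := by
        rw [← mul_pow]; ring
    _ ≤ (𝓢.rMin ^ 2 * 𝓢.rMin ^ n) ^ s := by gcongr
    _ = (𝓢.rMin ^ (n + 1 + 1)) ^ s := by ring
    _ ≤ |𝓢.wordRatio w| ^ s := by
        gcongr
        exact 𝓢.rMin_pow_succ_le_of_mem_level hw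
    _ ≤ wordWeight p w := 𝓢.pow_abs_wordRatio_le_wordWeight hs w
    _ = wordWeight p w * μ.real (𝓢.wordMap w ⁻¹' Metric.ball z v) := by rw [hone, mul_one]
    _ ≤ μ.real (Metric.ball z v) := by
        rw [hFE _ measurableSet_ball]
        exact Finset.single_le_sum
          (f := fun w => wordWeight p w * μ.real (𝓢.wordMap w ⁻¹' Metric.ball z v))
          (fun w _ => mul_nonneg (wordWeight_nonneg hμ.p_pos w) measureReal_nonneg)
          ((hF w).2 hw)

/-- The maps have no common fixed point, as the support is not a singleton. -/
lemma exists_map_ne (hμ : 𝓢.IsSelfSimilarMeasure p μ) (hsupp : μ.support = Icc (0 : ℝ) 1)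
    (x₀ : ℝ) : ∃ j, 𝓢.map j x₀ ≠ x₀ := by
  by_contra! h
  have hw : ∀ w, 𝓢.wordMap w x₀ = x₀ := fun w => by
    induction w with
    | nil => rfl
    | cons j w ih => rw [wordMap_cons, ih, h]
  have key : ∀ z ∈ Icc (0 : ℝ) 1, x₀ = z := by
    intro z hz
    refine eq_of_forall_dist_le fun ε hε => ?_
    have hx : 0 < 2 + |x₀| := by positivity
    obtain ⟨n, hn⟩ := exists_pow_lt_of_lt_one (div_pos hε hx) 𝓢.rMin_lt_one
    obtain ⟨w, hwn, y, hy, hyz⟩ :=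
      hμ.exists_mem_level_dist_lt hsupp n hz (pow_pos 𝓢.rMin_pos n)
    have h1 : dist x₀ (𝓢.wordMap w y) ≤ 𝓢.rMin ^ n * (1 + |x₀|) := by
      nth_rewrite 1 [← hw w]
      rw [dist_wordMap]
      refine mul_le_mul hwn.1 ?_ dist_nonneg (pow_pos 𝓢.rMin_pos n).le
      rw [Real.dist_eq]
      calc |x₀ - y| ≤ |x₀| + |y| := abs_sub _ _
        _ ≤ 1 + |x₀| := by rw [abs_of_nonneg hy.1]; linarith [hy.2]
    rw [lt_div_iff₀ hx] at hn
    linarith [dist_triangle x₀ (𝓢.wordMap w y) z]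
  have := key 0 (by simp)
  have := key 1 (by simp)
  linarith

end IsSelfSimilarMeasure

/-! ### Counting pieces under weak separation -/

/-- A separation bound for the orbit of one point `y` bounds the number of values at `y` of the
maps `S_w`, `w ∈ Λ_n`, whose pieces come close to a given point. -/
lemma exists_card_image_eval_le {y : ℝ} {M : ℕ}
    (hM : ∀ (n : ℕ) (c : ℝ), ((fun σ => 𝓢.wordMap σ y) '' 𝓢.level n ∩
      Metric.closedBall c (𝓢.rMin ^ n)).encard ≤ M) :
    ∃ K : ℕ, ∀ (n : ℕ) (x : ℝ) (G : Finset (ℝ → ℝ)),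
      (∀ f ∈ G, ∃ w ∈ 𝓢.level n, 𝓢.wordMap w = f ∧
        ∃ z ∈ Icc (0 : ℝ) 1, dist x (f z) ≤ 𝓢.rMin ^ n) →
      (G.image fun f => f y).card ≤ K := by
  let L : ℤ := ⌈2 + |y|⌉
  refine ⟨M * (Finset.Icc (-L) L).card, fun n x G hG => ?_⟩
  have hρ : 0 < 𝓢.rMin ^ n := pow_pos 𝓢.rMin_pos n
  refine Finset.card_le_mul_card_image_of_maps_to (f := fun a => ⌊(a - x) / 𝓢.rMin ^ n⌋)
    ?_ M ?_
  · intro a ha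
    obtain ⟨f, hf, rfl⟩ := Finset.mem_image.1 ha
    obtain ⟨w, hw, rfl, z, hz, hxz⟩ := hG f hf
    have h1 : dist (𝓢.wordMap w y) (𝓢.wordMap w z) ≤ 𝓢.rMin ^ n * (1 + |y|) := by
      rw [dist_wordMap]
      refine mul_le_mul hw.1 ?_ dist_nonneg hρ.le
      rw [Real.dist_eq]
      calc |y - z| ≤ |y| + |z| := abs_sub _ _
        _ ≤ 1 + |y| := by rw [abs_of_nonneg hz.1]; linarith [hz.2]
    have h2 : |𝓢.wordMap w y - x| ≤ 𝓢.rMin ^ n * (2 + |y|) := by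
      rw [← Real.dist_eq]
      have := dist_triangle_right (𝓢.wordMap w y) x (𝓢.wordMap w z)
      linarith
    have h3 : |(𝓢.wordMap w y - x) / 𝓢.rMin ^ n| ≤ L := by
      rw [abs_div, abs_of_pos hρ, div_le_iff₀ hρ, mul_comm]
      exact h2.trans (mul_le_mul_of_nonneg_left (Int.le_ceil _) hρ.le)
    rw [abs_le] at h3
    rw [Finset.mem_Icc]
    refine ⟨Int.le_floor.2 (by push_cast; exact h3.1), ?_⟩
    exact_mod_cast (Int.floor_le _).trans h3.2
  · intro k _
    have h := hM n (x + k * 𝓢.rMin ^ n)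
    have hsub : (((G.image fun f => f y).filter
        fun a => ⌊(a - x) / 𝓢.rMin ^ n⌋ = k : Finset ℝ) : Set ℝ) ⊆
        (fun σ => 𝓢.wordMap σ y) '' 𝓢.level n ∩
          Metric.closedBall (x + k * 𝓢.rMin ^ n) (𝓢.rMin ^ n) := by
      intro a ha
      obtain ⟨ha, hk⟩ := Finset.mem_filter.1 (Finset.mem_coe.1 ha)
      obtain ⟨f, hf, rfl⟩ := Finset.mem_image.1 ha
      obtain ⟨w, hw, rfl, -⟩ := hG f hf
      refine ⟨⟨w, hw, rfl⟩, ?_⟩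
      obtain ⟨h1, h2⟩ := Int.floor_eq_iff.1 hk
      rw [le_div_iff₀ hρ] at h1
      rw [div_lt_iff₀ hρ] at h2
      rw [Metric.mem_closedBall, Real.dist_eq, abs_le]
      constructor <;> linarith
    have h' := (Set.encard_le_encard hsub).trans h
    rw [Set.encard_coe_eq_coe_finsetCard] at h'
    exact_mod_cast h'

/-- Under weak separation, the number of distinct maps `S_w`, `w ∈ Λ_n`, whose pieces come within
`r_min ^ n` of a given point is bounded: such a map is determined by its values at two points of
the orbit of `x₀`. -/
lemma WeakSeparation.exists_card_le {𝓢 : SimilarityIFS m} {p : Fin (m + 1) → ℝ} {μ : Measure ℝ}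
    (hWSC : 𝓢.WeakSeparation) (hμ : 𝓢.IsSelfSimilarMeasure p μ)
    (hsupp : μ.support = Icc (0 : ℝ) 1) :
    ∃ K : ℕ, ∀ (n : ℕ) (x : ℝ) (G : Finset (ℝ → ℝ)),
      (∀ f ∈ G, ∃ w ∈ 𝓢.level n, 𝓢.wordMap w = f ∧
        ∃ z ∈ Icc (0 : ℝ) 1, dist x (f z) ≤ 𝓢.rMin ^ n) → G.card ≤ K := by
  obtain ⟨x₀, M, hM⟩ := hWSC
  obtain ⟨j, hj⟩ := hμ.exists_map_ne hsupp x₀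
  obtain ⟨K₁, hK₁⟩ := 𝓢.exists_card_image_eval_le (y := x₀) fun n c => hM n [] c
  obtain ⟨K₂, hK₂⟩ := 𝓢.exists_card_image_eval_le (y := 𝓢.map j x₀) fun n c => hM n [j] c
  refine ⟨K₁ * K₂, fun n x G hG => ?_⟩
  calc G.card ≤ ((G.image fun f => f x₀) ×ˢ (G.image fun f => f (𝓢.map j x₀))).card := by
        refine Finset.card_le_card_of_injOn (fun f => (f x₀, f (𝓢.map j x₀))) ?_ ?_
        · intro f hf
          exact Finset.mem_coe.2 (Finset.mem_product.2
            ⟨Finset.mem_image_of_mem _ hf, Finset.mem_image_of_mem _ hf⟩)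
        · intro f hf g hg hfg
          obtain ⟨w, -, rfl, -⟩ := hG f hf
          obtain ⟨v, -, rfl, -⟩ := hG g hg
          obtain ⟨h1, h2⟩ := Prod.mk.inj hfg
          have e1 := 𝓢.wordMap_sub w (𝓢.map j x₀) x₀
          have e2 := 𝓢.wordMap_sub v (𝓢.map j x₀) x₀
          rw [h1, h2, e2] at e1
          have hr := mul_right_cancel₀ (sub_ne_zero.2 hj) e1
          ext t
          have e3 := 𝓢.wordMap_sub w t x₀
          have e4 := 𝓢.wordMap_sub v t x₀
          rw [← hr] at e3
          linarith
    _ ≤ K₁ * K₂ := by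
        rw [Finset.card_product]
        exact Nat.mul_le_mul (hK₁ n x G hG) (hK₂ n x G hG)

end SimilarityIFS

/-! ### Comparing scales through finitely many pieces -/

/-- The mass `g t` of the ball of radius `t` about a point is compared across scales. The pieces
`f ∈ G` have weights `P f` and distances `δ f` to the point: the mass at scale `t` is at most the
weight of the pieces at distance less than `t`, and a piece at distance at most `t / 2` contributes
a fixed proportion of its weight. If the heaviest piece seen at scale `t` is at distance `δ`, then
a doubling step at scale `2 δ` replaces `t` by `δ`, where that piece is no longer seen; so the
number of doubling steps is at most the number of pieces, whatever the ratio of the scales. -/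
lemma le_pow_mul_of_finite_pieces {ι : Type*} (G : Finset ι) (P δ : ι → ℝ) (g : ℝ → ℝ)
    {r T B D : ℝ} {K : ℕ} (hg : Monotone g) (hg0 : ∀ t, 0 ≤ g t) (hr : 0 < r) (hB : 1 ≤ B)
    (hD : 1 ≤ D) (hK : 1 ≤ K) (hcard : (G.filter fun f => δ f < T).card ≤ K)
    (hupper : ∀ t, 0 < t → t ≤ T → g t ≤ ∑ f ∈ G.filter (fun f => δ f < t), P f)
    (hlower : ∀ f ∈ G, ∀ t, r ≤ t → t ≤ 2 * T → δ f ≤ t / 2 → P f ≤ B * g t)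
    (hdouble : ∀ t, r ≤ t → t ≤ 2 * T → g t ≤ D * g (t / 2)) :
    g T ≤ (K * B * D) ^ K * g r := by
  have hK' : (1 : ℝ) ≤ K := by exact_mod_cast hK
  have hA : 1 ≤ K * B * D := one_le_mul_of_one_le_of_one_le
    (one_le_mul_of_one_le_of_one_le hK' hB) hD
  have key : ∀ k : ℕ, ∀ t, t ≤ T → (G.filter fun f => δ f < t).card ≤ k →
      g t ≤ (K * B * D) ^ k * g r := by
    intro k
    induction k with
    | zero =>
      intro t htT hcard
      rcases le_or_gt t r with htr | htr
      · simpa using hg htr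
      · have h := hupper t (hr.trans htr) htT
        rw [Finset.card_eq_zero.1 (Nat.le_zero.1 hcard), Finset.sum_empty] at h
        simpa using h.trans (hg0 r)
    | succ k ih =>
      intro t htT hcard'
      rcases le_or_gt t r with htr | htr
      · exact (hg htr).trans (le_mul_of_one_le_left (hg0 r) (one_le_pow₀ hA))
      rcases (G.filter fun f => δ f < t).eq_empty_or_nonempty with he | hne
      · have h := hupper t (hr.trans htr) htT
        rw [he, Finset.sum_empty] at h
        exact h.trans (mul_nonneg (by positivity) (hg0 r))
      obtain ⟨f, hf, hmax⟩ := Finset.exists_max_image _ P hne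
      have hfG := (Finset.mem_filter.1 hf).1
      have hft := (Finset.mem_filter.1 hf).2
      have hsub : (G.filter fun f => δ f < t) ⊆ G.filter fun f => δ f < T :=
        Finset.monotone_filter_right _ fun _ _ h => h.trans_le htT
      have hsum : g t ≤ (G.filter fun f => δ f < t).card * P f := by
        rw [← nsmul_eq_mul]
        exact (hupper t (hr.trans htr) htT).trans (Finset.sum_le_card_nsmul _ _ _ hmax)
      have hcardK : ((G.filter fun f => δ f < t).card : ℝ) ≤ K := by
        exact_mod_cast (Finset.card_le_card hsub).trans hcard
      -- Any multiple of `g` bounding `P f` thus bounds `g t`, up to the factor `K`.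
      have hstep : ∀ a, 0 ≤ a → P f ≤ a → g t ≤ K * a := fun a ha h =>
        hsum.trans ((mul_le_mul_of_nonneg_left h (Nat.cast_nonneg _)).trans
          (mul_le_mul_of_nonneg_right hcardK ha))
      have hB0 : 0 ≤ B := by linarith
      have hD0 : 0 ≤ D := by linarith
      rcases le_or_gt (δ f) (r / 2) with hδ | hδ
      · have h := hstep _ (mul_nonneg hB0 (hg0 r)) (hlower f hfG r le_rfl (by linarith) hδ)
        calc g t ≤ K * (B * g r) := h
          _ ≤ K * B * D * g r := by
              have : 0 ≤ K * B * g r := mul_nonneg (by positivity) (hg0 r)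
              nlinarith
          _ ≤ (K * B * D) ^ (k + 1) * g r :=
              mul_le_mul_of_nonneg_right (le_self_pow₀ hA (by simp)) (hg0 r)
      · have hcardδ : (G.filter fun f' => δ f' < δ f).card ≤ k := by
          refine Nat.le_of_lt_succ ((Finset.card_lt_card ?_).trans_le hcard')
          refine (Finset.ssubset_iff_of_subset ?_).2 ⟨f, hf, by simp⟩
          exact Finset.monotone_filter_right _ fun _ _ h => h.trans hft
        have h1 := hlower f hfG (2 * δ f) (by linarith) (by linarith) (by linarith)
        have h2 := hdouble (2 * δ f) (by linarith) (by linarith)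
        rw [mul_div_cancel_left₀ _ (two_ne_zero' ℝ)] at h2
        have h3 := hstep _ (by have := hg0 (δ f); positivity)
          (h1.trans (mul_le_mul_of_nonneg_left h2 hB0))
        calc g t ≤ K * (B * (D * g (δ f))) := h3
          _ = K * B * D * g (δ f) := by ring
          _ ≤ K * B * D * ((K * B * D) ^ k * g r) :=
              mul_le_mul_of_nonneg_left (ih _ (hft.le.trans htT) hcardδ) (by positivity)
          _ = (K * B * D) ^ (k + 1) * g r := by ring
  exact key K T le_rfl hcard

/-! ### Finite upper `Φ`-dimension and `Φ`-doubling -/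

section Doubling

variable {Φ : ℝ → ℝ}

lemma IsDimensionFunction.rpow_le_self (hΦ : IsDimensionFunction Φ) {R : ℝ}
    (hR : R ∈ Ioo (0 : ℝ) 1) : R ^ (1 + Φ R) ≤ R := by
  have h := Real.rpow_le_rpow_of_exponent_ge hR.1 hR.2.le
    (show (1 : ℝ) ≤ 1 + Φ R by linarith [hΦ.nonneg R hR])
  rwa [Real.rpow_one] at h

/-- If ball masses are bounded below by a power of the radius, a competing exponent of the upper
`Φ`-dimension gives `Φ`-doubling: compare the scales `R` and `R ^ (1 + Φ R) / 2`. -/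
lemma isPhiDoubling_of_mem_upperPhiExponents {X : Type*} [MetricSpace X] [MeasurableSpace X]
    {μ : Measure X} [IsProbabilityMeasure μ] (hΦ : IsDimensionFunction Φ) {c : ℝ} {s : ℕ}
    (hc : 0 < c)
    (hlow : ∀ z ∈ μ.support, ∀ v : ℝ, 0 < v → v ≤ 1 → c * v ^ s ≤ μ.real (Metric.ball z v))
    {α : ℝ} (hα : α ∈ upperPhiExponents Φ μ) : IsPhiDoubling Φ μ := by
  obtain ⟨C₁, C₂, hC₁, hC₁', hC₂, h⟩ := hα
  set γ := max α 1
  have hγ : 0 < γ := lt_of_lt_of_le one_pos (le_max_right _ _)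
  set q := c * (C₁ / 2) ^ s
  have hq : 0 < q := by positivity
  set C := max 1 (max (C₂ * 2 ^ γ) q⁻¹)
  have hCa : C₂ * 2 ^ γ ≤ C := (le_max_left _ _).trans (le_max_right _ _)
  have hCb : q⁻¹ ≤ C := (le_max_right _ _).trans (le_max_right _ _)
  have hC : 1 ≤ C := le_max_left _ _
  refine ⟨C, γ, hC, hγ, fun x hx R hR hR1 => ?_⟩
  rcases le_or_gt R C₁ with hRC | hRC
  · have hRI : R ∈ Ioo (0 : ℝ) 1 := ⟨hR, hRC.trans_lt hC₁'⟩
    have hpos : 0 < R ^ (1 + Φ R) := Real.rpow_pos_of_pos hR _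
    have hle := hΦ.rpow_le_self hRI
    have hr : 0 < R ^ (1 + Φ R) / 2 := half_pos hpos
    have h1 := h _ R hr (half_lt_self hpos) hle hR hRC x hx
    have hrR : R ^ (1 + Φ R) / 2 ≤ R / 2 := by linarith
    have hball : 0 < μ.real (Metric.ball x (R ^ (1 + Φ R) / 2)) :=
      (by positivity : (0 : ℝ) < _).trans_le (hlow x hx _ hr (by linarith))
    have hquot : R / (R ^ (1 + Φ R) / 2) = 2 * R ^ (-Φ R) := by
      rw [Real.rpow_add hR, Real.rpow_one, Real.rpow_neg hR.le]
      have := Real.rpow_pos_of_pos hR (Φ R)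
      field_simp
    have hone : 1 ≤ R / (R ^ (1 + Φ R) / 2) := by
      rw [le_div_iff₀ hr]
      linarith
    rw [div_le_iff₀ hball] at h1
    calc μ.real (Metric.ball x R)
        ≤ C₂ * (R / (R ^ (1 + Φ R) / 2)) ^ α * μ.real (Metric.ball x (R ^ (1 + Φ R) / 2)) := h1
      _ ≤ C₂ * (R / (R ^ (1 + Φ R) / 2)) ^ γ * μ.real (Metric.ball x (R / 2)) := by
          have := Real.rpow_le_rpow_of_exponent_le hone (le_max_left α 1)
          have := measureReal_mono (μ := μ) (Metric.ball_subset_ball (x := x) hrR)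
          gcongr
      _ = C₂ * 2 ^ γ * R ^ (-(γ * Φ R)) * μ.real (Metric.ball x (R / 2)) := by
          rw [hquot, Real.mul_rpow zero_le_two (Real.rpow_nonneg hR.le _), ← Real.rpow_mul hR.le,
            show -Φ R * γ = -(γ * Φ R) by ring]
          ring
      _ ≤ C * R ^ (-(γ * Φ R)) * μ.real (Metric.ball x (R / 2)) := by gcongr
  · have hpow : 1 ≤ R ^ (-(γ * Φ R)) := by
      rcases hR1.eq_or_lt with rfl | hlt
      · simp
      · exact Real.one_le_rpow_of_pos_of_le_one_of_nonpos hR hR1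
          (neg_nonpos.2 (mul_nonneg hγ.le (hΦ.nonneg R ⟨hR, hlt⟩)))
    have hball : q ≤ μ.real (Metric.ball x (R / 2)) :=
      (hlow x hx (C₁ / 2) (by linarith) (by linarith)).trans
        (measureReal_mono (Metric.ball_subset_ball (by linarith)))
    calc μ.real (Metric.ball x R) ≤ 1 := measureReal_le_one
      _ = q⁻¹ * 1 * q := by field_simp
      _ ≤ C * R ^ (-(γ * Φ R)) * μ.real (Metric.ball x (R / 2)) := by gcongr

/-- At scales `t` between `r ≤ R ^ (1 + Φ R)` and `R`, the doubling factor `t ^ (-γ Φ(t))` is at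
most a fixed power of `R / r`, because `R ^ (-Φ R) ≤ R / r` and `Φ` is increasing. -/
lemma rpow_neg_mul_le_div_rpow (hΦ : IsDimensionFunction Φ) (hinc : MonotoneOn Φ (Ioo 0 1))
    {γ r t R : ℝ} (hγ : 0 < γ) (hr : 0 < r) (hrR : r < R ^ (1 + Φ R)) (hR : R ≤ 1 / 2)
    (hrt : r ≤ t) (htR : t ≤ R) :
    t ^ (-(γ * Φ t)) ≤ (R / r) ^ (γ * (1 + Φ (1 / 2))) := by
  have ht : 0 < t := hr.trans_le hrt
  have hR0 : 0 < R := ht.trans_le htR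
  have hRI : R ∈ Ioo (0 : ℝ) 1 := ⟨hR0, by linarith⟩
  have hmono : Φ t ≤ Φ R := hinc ⟨ht, by linarith⟩ hRI htR
  have hmono' : Φ R ≤ Φ (1 / 2) := hinc hRI ⟨by norm_num, by norm_num⟩ hR
  have hΦR := hΦ.nonneg R hRI
  have hX : 1 ≤ R / r := by
    rw [le_div_iff₀ hr]
    linarith
  have hX0 : 0 ≤ R / r := by positivity
  have hRΦ : (R⁻¹) ^ Φ R ≤ R / r := by
    rw [le_div_iff₀ hr, Real.inv_rpow hR0.le, inv_mul_le_iff₀ (Real.rpow_pos_of_pos hR0 _)]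
    calc r ≤ R ^ (1 + Φ R) := hrR.le
      _ = R ^ Φ R * R := by rw [Real.rpow_add hR0, Real.rpow_one, mul_comm]
  calc t ^ (-(γ * Φ t)) ≤ t ^ (-(γ * Φ R)) := by
        apply Real.rpow_le_rpow_of_exponent_ge ht (by linarith)
        have := mul_le_mul_of_nonneg_left hmono hγ.le
        linarith
    _ = (t⁻¹) ^ (γ * Φ R) := by rw [Real.rpow_neg ht.le, Real.inv_rpow ht.le]
    _ ≤ (R / r * R⁻¹) ^ (γ * Φ R) := by
        refine Real.rpow_le_rpow (by positivity) ?_ (by positivity)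
        rw [show R / r * R⁻¹ = r⁻¹ by field_simp]
        exact inv_anti₀ hr hrt
    _ = (R / r) ^ (γ * Φ R) * ((R⁻¹) ^ Φ R) ^ γ := by
        rw [Real.mul_rpow hX0 (by positivity), ← Real.rpow_mul (by positivity), mul_comm (Φ R)]
    _ ≤ (R / r) ^ (γ * Φ (1 / 2)) * (R / r) ^ γ := by
        gcongr
    _ = (R / r) ^ (γ * (1 + Φ (1 / 2))) := by
        rw [← Real.rpow_add (by positivity)]
        ring_nf

end Doubling

namespace SimilarityIFS

variable {m : ℕ} {𝓢 : SimilarityIFS m} {p : Fin (m + 1) → ℝ} {μ : Measure ℝ} {Φ : ℝ → ℝ}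

/-- Under weak separation, `Φ`-doubling yields a competing exponent of the upper `Φ`-dimension. The
pieces of size comparable to `R` enter with their distances to the centre of the balls. -/
lemma WeakSeparation.nonempty_upperPhiExponents (hWSC : 𝓢.WeakSeparation)
    (hμ : 𝓢.IsSelfSimilarMeasure p μ) (hsupp : μ.support = Icc (0 : ℝ) 1)
    (hΦ : IsDimensionFunction Φ) (hinc : MonotoneOn Φ (Ioo 0 1)) (hdbl : IsPhiDoubling Φ μ) :
    (upperPhiExponents Φ μ).Nonempty := by
  have := hμ.isProbabilityMeasure
  obtain ⟨K₀, hK₀⟩ := hWSC.exists_card_le hμ hsupp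
  obtain ⟨c, s, hc, hlow⟩ := hμ.exists_mul_pow_le_real_ball hsupp
  obtain ⟨C, γ, hC, hγ, hdbl⟩ := hdbl
  have hmin := 𝓢.rMin_pos
  have hmin1 := 𝓢.rMin_lt_one
  set K := max K₀ 1
  set β := γ * (1 + Φ (1 / 2))
  set q := c * (𝓢.rMin / 2) ^ s
  have hq : 0 < q := by positivity
  set b := max 1 q⁻¹
  have hb : 1 ≤ b := le_max_left _ _
  have hβ : 0 ≤ β := by
    have := hΦ.nonneg (1 / 2) ⟨by norm_num, by norm_num⟩
    positivity
  refine ⟨(s + β) * K + β, 1 / 2, C * (K * b * C) ^ K, by norm_num, by norm_num, ?_, ?_⟩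
  · have : 1 ≤ K := le_max_right _ _
    positivity
  intro r R hr hrR hRle hR hR2 x hx
  have hX : 1 ≤ R / r := by
    rw [le_div_iff₀ hr]
    linarith
  have hX0 : 0 < R / r := by positivity
  have hdbl' : ∀ t, r ≤ t → t ≤ R →
      μ.real (Metric.ball x t) ≤ C * (R / r) ^ β * μ.real (Metric.ball x (t / 2)) := by
    intro t hrt htR
    refine (hdbl x hx t (hr.trans_le hrt) (by linarith)).trans ?_
    have := rpow_neg_mul_le_div_rpow hΦ hinc hγ hr hrR hR2 hrt htR
    gcongr
  obtain ⟨n, hn, hn'⟩ := exists_nat_pow_near_of_lt_one hR (by linarith) hmin hmin1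
  obtain ⟨G, P, hG, hP, hGE⟩ := hμ.exists_finset_maps n
  have hcont : ∀ f ∈ G, Continuous f := fun f hf => by
    obtain ⟨w, -, rfl⟩ := hG f hf
    exact 𝓢.continuous_wordMap w
  have hne : ∀ f : ℝ → ℝ, (f '' Icc (0 : ℝ) 1).Nonempty := fun f =>
    (nonempty_Icc.2 zero_le_one).image f
  have hnear : ∀ f ∈ G, ∃ y ∈ Icc (0 : ℝ) 1, Metric.infDist x (f '' Icc 0 1) = dist x (f y) := by
    intro f hf
    obtain ⟨_, ⟨y, hy, rfl⟩, h⟩ :=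
      (isCompact_Icc.image (hcont f hf)).exists_infDist_eq_dist (hne f) x
    exact ⟨y, hy, h⟩
  have hmain := le_pow_mul_of_finite_pieces G P (fun f => Metric.infDist x (f '' Icc 0 1))
    (fun t => μ.real (Metric.ball x t)) (r := r) (T := R / 2) (B := b * (R / r) ^ s)
    (D := C * (R / r) ^ β) (K := K)
    (fun t t' h => measureReal_mono (Metric.ball_subset_ball h)) (fun t => measureReal_nonneg) hr
    (one_le_mul_of_one_le_of_one_le hb (one_le_pow₀ hX))
    (one_le_mul_of_one_le_of_one_le hC (Real.one_le_rpow hX hβ)) (le_max_right _ _) ?_ ?_ ?_ ?_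
  · calc μ.real (Metric.ball x R) / μ.real (Metric.ball x r)
        ≤ C * (R / r) ^ β * (K * (b * (R / r) ^ s) * (C * (R / r) ^ β)) ^ K := by
          rw [div_le_iff₀ (IsSelfSimilarMeasure.real_ball_pos hx hr), mul_assoc _ _ (μ.real _)]
          exact (hdbl' R (by linarith) le_rfl).trans
            (mul_le_mul_of_nonneg_left hmain (by positivity))
      _ = C * (K * b * C) ^ K * (((R / r) ^ s * (R / r) ^ β) ^ K * (R / r) ^ β) := by
          rw [show K * (b * (R / r) ^ s) * (C * (R / r) ^ β) =
            (K * b * C) * ((R / r) ^ s * (R / r) ^ β) by ring, mul_pow]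
          ring
      _ = C * (K * b * C) ^ K * (R / r) ^ ((s + β) * K + β) := by
          rw [Real.rpow_add hX0, Real.rpow_mul hX0.le (s + β), Real.rpow_natCast, Real.rpow_add hX0,
            Real.rpow_natCast]
  · refine (hK₀ n x _ fun f hf => ?_).trans (le_max_left _ _)
    obtain ⟨hfG, hfR⟩ := Finset.mem_filter.1 hf
    obtain ⟨w, hw, hwf⟩ := hG f hfG
    obtain ⟨y, hy, hxy⟩ := hnear f hfG
    exact ⟨w, hw, hwf, y, hy, by linarith⟩
  · intro t ht _
    rw [hGE _ measurableSet_ball, Finset.sum_filter]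
    refine Finset.sum_le_sum fun f _ => ?_
    split_ifs with h
    · exact mul_le_of_le_one_right (hP f) measureReal_le_one
    · rw [IsSelfSimilarMeasure.real_eq_zero hsupp, mul_zero]
      intro y hy hxy
      refine h ((Metric.infDist_le_dist_of_mem (mem_image_of_mem f hy)).trans_lt ?_)
      rw [dist_comm]
      exact hxy
  · intro f hf t hrt htR hft
    obtain ⟨w, hw, hwf⟩ := hG f hf
    obtain ⟨y, hy, hxy⟩ := hnear f hf
    have ht : 0 < t := hr.trans_le hrt
    -- The piece `f` has size at most `R / r_min`, so `f` maps the ball of radius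
    -- `t * r_min / (2 * R)` about `y` into a ball of radius `t / 2`.
    have hv : 0 < t * 𝓢.rMin / (2 * R) := by positivity
    have hv1 : t * 𝓢.rMin / (2 * R) ≤ 1 := by
      rw [div_le_one (by positivity)]
      nlinarith
    have hsub : Metric.ball y (t * 𝓢.rMin / (2 * R)) ⊆ f ⁻¹' Metric.ball x t := by
      intro z hz
      have h1 : dist (f z) (f y) < t / 2 := by
        rw [← hwf, dist_wordMap]
        have hw0 : 0 < |𝓢.wordRatio w| := abs_pos.2 (𝓢.wordRatio_ne_zero w)
        have hwR : |𝓢.wordRatio w| * 𝓢.rMin ≤ R := by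
          have := mul_le_mul_of_nonneg_right hw.1 hmin.le
          rw [← pow_succ] at this
          exact this.trans hn.le
        calc |𝓢.wordRatio w| * dist z y
            < |𝓢.wordRatio w| * (t * 𝓢.rMin / (2 * R)) := mul_lt_mul_of_pos_left hz hw0
          _ = (|𝓢.wordRatio w| * 𝓢.rMin) * (t / (2 * R)) := by ring
          _ ≤ R * (t / (2 * R)) := mul_le_mul_of_nonneg_right hwR (by positivity)
          _ = t / 2 := by field_simp
      rw [mem_preimage, Metric.mem_ball]
      have h2 := dist_triangle (f z) (f y) x
      rw [dist_comm (f y) x] at h2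
      linarith
    have hmass : q * ((R / r) ^ s)⁻¹ ≤ μ.real (f ⁻¹' Metric.ball x t) := by
      refine le_trans ?_ ((hlow y hy _ hv hv1).trans (measureReal_mono hsub))
      rw [← inv_pow, mul_assoc, ← mul_pow, inv_div]
      refine mul_le_mul_of_nonneg_left (pow_le_pow_left₀ (by positivity) ?_ s) hc.le
      calc 𝓢.rMin / 2 * (r / R) = r * 𝓢.rMin / (2 * R) := by field_simp
        _ ≤ t * 𝓢.rMin / (2 * R) := by gcongr
    have hball : P f * (q * ((R / r) ^ s)⁻¹) ≤ μ.real (Metric.ball x t) := by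
      rw [hGE _ measurableSet_ball]
      exact (mul_le_mul_of_nonneg_left hmass (hP f)).trans
        (Finset.single_le_sum (f := fun f => P f * μ.real (f ⁻¹' Metric.ball x t))
          (fun f _ => mul_nonneg (hP f) measureReal_nonneg) hf)
    have hXs : 0 < (R / r) ^ s := by positivity
    calc P f = q⁻¹ * (R / r) ^ s * (P f * (q * ((R / r) ^ s)⁻¹)) := by field_simp
      _ ≤ b * (R / r) ^ s * μ.real (Metric.ball x t) := by
          have : q⁻¹ ≤ b := le_max_right _ _
          have := hP f
          gcongr
  · intro t hrt htR
    exact hdbl' t hrt (by linarith)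

end SimilarityIFS

theorem propositionT
    (m : ℕ) (hm : 1 ≤ m) (𝓢 : SimilarityIFS m) (p : Fin (m + 1) → ℝ) (μ : Measure ℝ)
    (hμ : 𝓢.IsSelfSimilarMeasure p μ) (hWSC : 𝓢.WeakSeparation)
    (hsupp : μ.support = Icc (0 : ℝ) 1)
    (Φ : ℝ → ℝ) (hΦ : IsDimensionFunction Φ) (hinc : MonotoneOn Φ (Ioo 0 1))
    (hdbl : IsDoublingFunction Φ) :
    upperPhiDim Φ μ < ⊤ ↔ IsPhiDoubling Φ μ := by
  have := hμ.isProbabilityMeasure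
  have hfin : upperPhiDim Φ μ < ⊤ ↔ (upperPhiExponents Φ μ).Nonempty := by
    simp [upperPhiDim, iInf_lt_iff, EReal.coe_lt_top, Set.Nonempty]
  rw [hfin]
  constructor
  · rintro ⟨α, hα⟩
    obtain ⟨c, s, hc, hlow⟩ := hμ.exists_mul_pow_le_real_ball hsupp
    exact isPhiDoubling_of_mem_upperPhiExponents hΦ hc (hsupp ▸ hlow) hα
  · exact hWSC.nonempty_upperPhiExponents hμ hsupp hΦ hinc
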